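/- Let $\lambda<\kappa$ be uncountable cardinals with $\kappa$ regular, let $E^\kappa_\lambda:=\{\delta<\kappa\mid \operatorname{cf}(\delta)=\lambda\}$, let $\theta$ be a cardinal, and let $T$ be a set of ordinals (in particular, any stationary subset of $\kappa$). For each $\delta\in E^\kappa_\lambda$ let $J_\delta$ be a proper ideal over $\delta$ that is $\lambda$-complete (closed under unions of fewer than $\lambda$ of its members) and contains every bounded subset of $\delta$; write $J_\delta^+:=\mathcal P(\delta)\setminus J_\delta$. Let $\vec C=\langle C_\delta\mid\delta\in E^\kappa_\lambda\rangle$ be such that each $C_\delta$ is a closed unbounded subset of $\delta$ of order type at most $\lambda$, and suppose that for every club $D\subseteq\kappa$ there exists $\delta\in E^\kappa_\lambda$ such that $$\{\beta<\delta\mid \min(C_\delta\setminus(\beta+1))\in D\cap T\}\in J_\delta^+.$$ Suppose that at least one of the following holds: 1. $\theta=\lambda$ and $\diamondsuit^*(\lambda)$ holds, that is, there is a sequence $\langle\mathcal A_\alpha\mid\alpha<\lambda\rangle$ with $\mathcal A_\alpha\subseteq\mathcal P(\alpha)$ and $|\mathcal A_\alpha|\le|\alpha|$ such that for every $A\subseteq\lambda$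 there is a club $E\subseteq\lambda$ with $A\cap\alpha\in\mathcal A_\alpha$ for all $\alpha\in E$; 2. $\lambda$ is not strongly inaccessible, and $\theta$ is the least cardinal with $2^\theta\ge\lambda$; 3. $\theta^+=\lambda$; 4. $\theta=\omega$ and $\lambda$ is not ineffable. (Here $\lambda$ is ineffable if it is regular uncountable and for every sequence $\langle A_\alpha\mid\alpha<\lambda\rangle$ with $A_\alpha\subseteq\alpha$ there is $B\subseteq\lambda$ such that $\{\alpha<\lambda\mid B\cap\alpha=A_\alpha\}$ is stationary in $\lambda$.) Then there exists a sequence of maps $\langle h_\delta:\lambda\to\theta\mid\delta\in E^\kappa_\lambda\rangle$ such that for every club $D\subseteq\kappa$ there exists $\delta\in E^\kappa_\lambda$ such that for every $\tau<\theta$, $$\{\beta<\delta\mid h_\delta(\operatorname{otp}(C_\delta\cap\beta))=\tau\ \text{ and }\ \min(C_\delta\setminus(\beta+1))\in D\cap T\}\in J_\delta^+.$$ -/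

import Mathlib

open Set Cardinal Ordinal

universe u

namespace ClubGuessing

/-- The set of all ordinals below `κ` of cofinality `lam`. -/
def cofSet (κ lam : Cardinal.{u}) : Set Ordinal.{u} :=
  {δ | δ < κ.ord ∧ δ.cof = lam}

/-- `A`, a set of ordinals, is a closed and cofinal subset of the ordinal `δ`
(which is identified with the set of its predecessors). -/
def IsClubIn (A : Set Ordinal.{u}) (δ : Ordinal.{u}) : Prop :=
  A ⊆ Iio δ ∧ IsClub {x : Iio δ | (x : Ordinal.{u}) ∈ A}

/-- The order type of a set `A` of ordinals: the unique ordinal that is order isomorphic to `A`.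
It exists when `A` is bounded, see `nonempty_orderIso_otp`. -/
noncomputable def otp (A : Set Ordinal.{u}) : Ordinal.{u} :=
  sInf {o | Nonempty (Iio o ≃o A)}

theorem nonempty_orderIso_otp {A : Set Ordinal.{u}} {b : Ordinal.{u}} (hA : A ⊆ Iio b) :
    Nonempty (Iio (otp A) ≃o A) := by
  have key : ∃ o : Ordinal.{u}, Nonempty (Iio o ≃o A) := by
    have h1 : typeLT A ≤ typeLT (Iio b) :=
      Ordinal.type_le_iff'.2 ⟨(OrderEmbedding.ltEmbedding
        (⟨⟨fun x : A => (⟨x.1, hA x.2⟩ : Iio b), fun x y h => Subtype.ext (by simpa using h)⟩,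
          Iff.rfl⟩ : A ↪o Iio b))⟩
    rw [Ordinal.type_lt_Iio] at h1
    obtain ⟨o, ho⟩ := Ordinal.mem_range_lift_of_le h1
    rw [← Ordinal.type_lt_Iio] at ho
    obtain ⟨f⟩ := Ordinal.type_eq.1 ho
    exact ⟨o, ⟨OrderIso.ofRelIsoLT f⟩⟩
  exact csInf_mem (s := {o : Ordinal.{u} | Nonempty (Iio o ≃o A)}) key

/-- A `C`-sequence over a set `S` of ordinals. -/
def IsCSequence (S : Set Ordinal.{u}) (C : Ordinal.{u} → Set Ordinal.{u}) : Prop :=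
  ∀ δ ∈ S, IsClubIn (C δ) δ

/-- A `C`-sequence over `S` is `ξ`-bounded when all order types are at most `ξ`. -/
def IsBoundedBy (S : Set Ordinal.{u}) (C : Ordinal.{u} → Set Ordinal.{u})
    (ξ : Ordinal.{u}) : Prop :=
  ∀ δ ∈ S, otp (C δ) ≤ ξ

/-- The least element of `A` above `β`, that is, `min (A \ (β + 1))`. -/
noncomputable def nextIn (A : Set Ordinal.{u}) (β : Ordinal.{u}) : Ordinal.{u} :=
  sInf {γ | γ ∈ A ∧ β < γ}

/-- `J` is a `lam`-complete proper ideal over the ordinal `δ` which contains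
all bounded subsets of `δ`. A subset of `δ` is `J`-positive when it is not a member of `J`. -/
structure IsCompleteIdealOver (lam : Cardinal.{u}) {δ : Ordinal.{u}}
    (J : Order.Ideal (Set (Iio δ))) : Prop where
  proper : (univ : Set (Iio δ)) ∉ J
  bounded : ∀ γ < δ, {β : Iio δ | (β : Ordinal.{u}) < γ} ∈ J
  complete : ∀ (ι : Type u) (X : ι → Set (Iio δ)), #ι < lam → (∀ i, X i ∈ J) → (⋃ i, X i) ∈ J

/-- The diamond-star principle: there are families `𝒜 α` of at most `|α|` subsets of `α`,
for `α < lam`, such that every subset of `lam` is guessed by them on a club. -/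
def DiamondStar (lam : Cardinal.{u}) : Prop :=
  ∃ 𝒜 : Ordinal.{u} → Set (Set Ordinal.{u}),
    (∀ α < lam.ord, (∀ A ∈ 𝒜 α, A ⊆ Iio α) ∧ #(𝒜 α) ≤ Cardinal.lift.{u + 1} α.card) ∧
    ∀ A ⊆ Iio lam.ord, ∃ E, IsClubIn E lam.ord ∧ ∀ α ∈ E, A ∩ Iio α ∈ 𝒜 α

/-- Ineffable cardinals. -/
def IsIneffable (lam : Cardinal.{u}) : Prop :=
  ℵ₀ < lam ∧ lam.IsRegular ∧
    ∀ A : Ordinal.{u} → Set Ordinal.{u}, (∀ α < lam.ord, A α ⊆ Iio α) →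
      ∃ B ⊆ Iio lam.ord, IsStationary {α : Iio lam.ord | B ∩ Iio (α : Ordinal.{u}) = A α}

end ClubGuessing

/-! Restrict `J δ` to the points where `C δ` guesses `D` and project along β ↦ otp(C_δ ∩ β). This
gives `lam`-complete ideals `guessNull` on `lam` that grow as `D` shrinks (`isGuessing_guessNull`),
and the task becomes to colour `lam` so that all classes are positive. As `lam < κ`, any `lam` many
clubs have a common refinement, so `lam` many failures can be witnessed by one club.

Two mechanisms exploit this. By `exists_stable`, positivity of the members of a family of size below
`lam` can be frozen. So if no colouring works, some `D` leaves no `δ` with `θ` many disjoint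
positive sets from a prescribed small family (`exists_not_hasDisjointPos`). An Ulam matrix
contradicts this when θ⁺ = `lam`, and the tree of initial segments of `lam` many subsets of `θ`
contradicts it when `θ` is least with 2^θ ≥ `lam`.

For diamond-star and for non-ineffable strong limits, failure allows pressing down: a function
tending to `lam` modulo the ideals can be lowered, almost everywhere, to another such function.
Doing so ω times yields a descending sequence of ordinals (`false_of_descent`). If `lam` is not a
strong limit, the last hypothesis reduces to the case of the least `θ`. -/

namespace ClubGuessing

/-! ### Null ideals and guessing systems -/

/-- `I` is (the family of members of) a `lam`-complete, possibly improper, ideal of sets of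
ordinals which contains all bounded subsets of `lam` and the complement of `lam`. -/
structure IsNullIdeal (lam : Cardinal.{u}) (I : Set Ordinal.{u} → Prop) : Prop where
  mono : ∀ {S S' : Set Ordinal.{u}}, S ⊆ S' → I S' → I S
  iUnion : ∀ {ι : Type (u + 1)} (X : ι → Set Ordinal.{u}),
    #ι < Cardinal.lift.{u + 1} lam → (∀ i, I (X i)) → I (⋃ i, X i)
  bounded : ∀ η < lam.ord, I (Iio η)
  compl : I (Ici lam.ord)

/-- A system of ideals indexed by a directed order `𝒟` (of clubs, say) and by a set `E`,
increasing as the first index decreases and always proper at some member of `E`. -/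
structure IsGuessing (lam : Cardinal.{u}) {𝒟 E : Type (u + 1)} [Preorder 𝒟]
    (N : 𝒟 → E → Set Ordinal.{u} → Prop) : Prop where
  ideal : ∀ D δ, IsNullIdeal lam (N D δ)
  anti : ∀ {D D' : 𝒟} {δ S}, D' ≤ D → N D δ S → N D' δ S
  exists_pos : ∀ D, ∃ δ, ¬ N D δ univ
  directed : ∀ {ι : Type (u + 1)} (f : ι → 𝒟), #ι ≤ Cardinal.lift.{u + 1} lam →
    ∃ D, ∀ i, D ≤ f i

/-- Every `D` has some `δ` at which all the `θ` many classes of a colouring are positive. -/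
def Partitions {𝒟 E : Type (u + 1)} (N : 𝒟 → E → Set Ordinal.{u} → Prop)
    (θ : Cardinal.{u}) : Prop :=
  ∃ h : E → Ordinal.{u} → Ordinal.{u}, (∀ δ x, h δ x < θ.ord) ∧
    ∀ D, ∃ δ, ∀ τ < θ.ord, ¬ N D δ {x | h δ x = τ}

/-- `θ` many members of the family `P` are positive and pairwise disjoint. -/
def HasDisjointPos {ι : Type (u + 1)} (I : Set Ordinal.{u} → Prop) (P : ι → Set Ordinal.{u})
    (θ : Cardinal.{u}) : Prop :=
  ∃ Q : Set ι, (∀ p ∈ Q, ¬ I (P p)) ∧ Q.PairwiseDisjoint P ∧ Cardinal.lift.{u + 1} θ ≤ #Q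

theorem mk_Iio_lt {lam : Cardinal.{u}} {a : Ordinal.{u}} (ha : a < lam.ord) :
    #(Iio a) < Cardinal.lift.{u + 1} lam := by
  rw [Cardinal.mk_Iio_ordinal, Cardinal.lift_lt]
  exact lt_ord.1 ha

namespace IsNullIdeal

variable {lam : Cardinal.{u}} {I : Set Ordinal.{u} → Prop}

theorem biUnion (hI : IsNullIdeal lam I) {a : Ordinal.{u}} (ha : a < lam.ord)
    {X : Ordinal.{u} → Set Ordinal.{u}} (hX : ∀ i < a, I (X i)) : I (⋃ i ∈ Iio a, X i) := by
  rw [biUnion_eq_iUnion]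
  exact hI.iUnion (fun i : Iio a => X i) (mk_Iio_lt ha) fun i => hX _ i.2

theorem iUnion_nat (hI : IsNullIdeal lam I) (hlam : ℵ₀ < lam) {X : ℕ → Set Ordinal.{u}}
    (hX : ∀ n, I (X n)) : I (⋃ n, X n) := by
  have := hI.iUnion (fun n : ULift.{u + 1} ℕ => X n.down) (by simpa using hlam) fun n => hX _
  exact hI.mono (iUnion_subset fun n => subset_iUnion (fun n : ULift.{u + 1} ℕ => X n.down) ⟨n⟩)
    this

theorem union (hI : IsNullIdeal lam I) (hlam : ℵ₀ < lam) {S S' : Set Ordinal.{u}}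
    (hS : I S) (hS' : I S') : I (S ∪ S') := by
  refine hI.mono ?_ (hI.iUnion_nat hlam (X := fun n => if n = 0 then S else S') fun n => ?_)
  · rintro x (hx | hx)
    · exact mem_iUnion.2 ⟨0, by simpa using hx⟩
    · exact mem_iUnion.2 ⟨1, by simpa using hx⟩
  · split_ifs <;> assumption

theorem singleton (hI : IsNullIdeal lam I) (hlam : ℵ₀ ≤ lam) (a : Ordinal.{u}) : I {a} := by
  obtain ha | ha := lt_or_ge a lam.ord
  · refine hI.mono ?_ (hI.bounded (Order.succ a) ((isSuccLimit_ord hlam).succ_lt ha))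
    simp
  · exact hI.mono (by simpa using ha) hI.compl

end IsNullIdeal

theorem HasDisjointPos.of_imp {ι : Type (u + 1)} {I I' : Set Ordinal.{u} → Prop}
    {P : ι → Set Ordinal.{u}} {θ : Cardinal.{u}} (h : HasDisjointPos I' P θ)
    (hI : ∀ S, I S → I' S) : HasDisjointPos I P θ := by
  obtain ⟨Q, h1, h2⟩ := h
  exact ⟨Q, fun p hp hp' => h1 p hp (hI _ hp'), h2⟩

/-- Surplus colours are merged into 0, which only enlarges a class. -/
theorem Partitions.of_le {𝒟 E : Type (u + 1)} {N : 𝒟 → E → Set Ordinal.{u} → Prop}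
    {θ θ' : Cardinal.{u}} (h : Partitions N θ') (hθ : θ ≤ θ') (h0 : θ ≠ 0)
    (hmono : ∀ D δ {S S' : Set Ordinal.{u}}, S ⊆ S' → N D δ S' → N D δ S) : Partitions N θ := by
  obtain ⟨h, -, h2⟩ := h
  have h0' : 0 < θ.ord := by
    rw [lt_ord, card_zero]; exact pos_iff_ne_zero.2 h0
  refine ⟨fun δ x => if h δ x < θ.ord then h δ x else 0, fun δ x => ?_, fun D => ?_⟩
  · dsimp only
    split_ifs with hx
    exacts [hx, h0']
  · obtain ⟨δ, hδ⟩ := h2 D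
    refine ⟨δ, fun τ hτ hN => hδ τ (hτ.trans_le (ord_le_ord.2 hθ)) (hmono D δ ?_ hN)⟩
    intro x (hx : h δ x = τ)
    simp [hx, hτ]

/-! ### Freezing positivity -/

namespace IsGuessing

variable {lam : Cardinal.{u}} {𝒟 E : Type (u + 1)} [Preorder 𝒟]
  {N : 𝒟 → E → Set Ordinal.{u} → Prop}

theorem directed_nat (hN : IsGuessing lam N) (hlam : ℵ₀ ≤ lam) (f : ℕ → 𝒟) :
    ∃ D, ∀ i, D ≤ f i := by
  obtain ⟨D, hD⟩ := hN.directed (fun n : ULift.{u + 1} ℕ => f n.down) (by simpa using hlam)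
  exact ⟨D, fun i => hD ⟨i⟩⟩

theorem directed_two (hN : IsGuessing lam N) (hlam : ℵ₀ ≤ lam) (D₁ D₂ : 𝒟) :
    ∃ D, D ≤ D₁ ∧ D ≤ D₂ := by
  obtain ⟨D, hD⟩ := hN.directed_nat hlam fun n => if n = 0 then D₁ else D₂
  exact ⟨D, by simpa using hD 0, by simpa using hD 1⟩

theorem directed_Iio (hN : IsGuessing lam N) (f : Iio lam.ord → 𝒟) : ∃ D, ∀ i, D ≤ f i :=
  hN.directed f (by simp [Cardinal.mk_Iio_ordinal])

/-- A monotone invariant with fewer than `lam` many possible elements can be frozen. -/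
theorem exists_stable (hN : IsGuessing lam N) {ι : Type (u + 1)}
    (hι : #ι < Cardinal.lift.{u + 1} lam) (X : 𝒟 → E → Set ι)
    (hX : ∀ {D D'} δ, D' ≤ D → X D' δ ⊆ X D δ) (G : 𝒟 → Set E)
    (hG : ∀ {D D'}, D' ≤ D → G D' ⊆ G D) (hne : ∀ D, (G D).Nonempty) :
    ∃ D₀, ∀ D ≤ D₀, ∃ δ ∈ G D, X D δ = X D₀ δ := by
  -- Otherwise each `D` has a refinement `s D` that changes `X` at every `δ ∈ G (s D)`. Iterating
  -- `lam` times and passing to a lower bound gives one `δ` at which `lam` many distinct elements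
  -- leave `X`.
  by_contra! hcon
  choose s hs hs' using hcon
  have low : ∀ (i : Iio lam.ord) (f : ∀ j : Iio lam.ord, j < i → 𝒟),
      ∃ D, ∀ j hj, D ≤ f j hj := by
    intro i f
    obtain ⟨D, hD⟩ := hN.directed (fun j : {j : Iio lam.ord // j < i} => f j.1 j.2)
      ((mk_subtype_le _).trans (by simp [Cardinal.mk_Iio_ordinal]))
    exact ⟨D, fun j hj => hD ⟨j, hj⟩⟩
  choose L hL using low
  let F : Iio lam.ord → 𝒟 := wellFounded_lt.fix fun i f => L i fun j hj => s (f j hj)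
  have hF : ∀ i j, j < i → F i ≤ s (F j) := by
    intro i j hj
    have : F i = L i fun j _ => s (F j) := wellFounded_lt.fix_eq _ i
    rw [this]
    exact hL i (fun j _ => s (F j)) j hj
  obtain ⟨D, hD⟩ := hN.directed_Iio fun i => s (F i)
  obtain ⟨δ, hδ⟩ := hne D
  have hp : ∀ i, ∃ p ∈ X (F i) δ, p ∉ X (s (F i)) δ := by
    intro i
    by_contra! h
    exact hs' (F i) δ (hG (hD i) hδ) (Subset.antisymm (hX δ (hs _)) h)
  choose p hp hp' using hp
  have hlt : ∀ i j, i < j → p i ≠ p j := fun i j hij h =>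
    hp' i (h ▸ hX δ (hF j i hij) (hp j))
  have hinj : Function.Injective p := fun i j h => by
    by_contra hij
    rcases lt_or_gt_of_ne hij with h' | h'
    exacts [hlt _ _ h' h, hlt _ _ h' h.symm]
  have := mk_le_of_injective hinj
  rw [Cardinal.mk_Iio_ordinal, card_ord] at this
  exact this.not_gt hι

/-- If there is no partition into `θ` pieces, then some `D` ensures that
a given small family has no `θ` many positive and pairwise disjoint members. -/
theorem exists_not_hasDisjointPos (hN : IsGuessing lam N) (hlam : ℵ₀ ≤ lam) {θ : Cardinal.{u}}
    (hθ : θ ≠ 0) (hnot : ¬ Partitions N θ) {ι : Type (u + 1)}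
    (hι : #ι < Cardinal.lift.{u + 1} lam) (P : E → ι → Set Ordinal.{u}) :
    ∃ D, ∀ δ, ¬ HasDisjointPos (N D δ) (P δ) θ := by
  classical
  by_contra! hcon
  -- The colouring comes from the disjoint sets that are positive at `D₀`; freezing keeps them
  -- positive, at a suitable `δ`, for any smaller `D'`.
  obtain ⟨D₀, hD₀⟩ := hN.exists_stable hι (fun D δ => {p | ¬ N D δ (P δ p)})
    (fun δ hD p hp hp' => hp (hN.anti hD hp')) (fun D => {δ | HasDisjointPos (N D δ) (P δ) θ})
    (fun hD δ hδ => hδ.of_imp fun _ => hN.anti hD) hcon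
  have h0 : 0 < θ.ord := by
    rw [lt_ord, card_zero]; exact pos_iff_ne_zero.2 hθ
  have key : ∀ δ, ∃ h : Ordinal.{u} → Ordinal.{u}, (∀ x, h x < θ.ord) ∧
      (HasDisjointPos (N D₀ δ) (P δ) θ →
        ∀ τ < θ.ord, ∃ p, ¬ N D₀ δ (P δ p) ∧ P δ p ⊆ {x | h x = τ}) := by
    intro δ
    by_cases hd : HasDisjointPos (N D₀ δ) (P δ) θ
    · obtain ⟨Q, hQ, hQd, hQc⟩ := hd
      have : #(Iio θ.ord) ≤ #Q := by simpa [Cardinal.mk_Iio_ordinal] using hQc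
      obtain ⟨q⟩ := this
      refine ⟨fun x => if hx : ∃ τ : Iio θ.ord, x ∈ P δ (q τ) then hx.choose else 0,
        fun x => ?_, fun _ τ hτ => ⟨q ⟨τ, hτ⟩, hQ _ (q ⟨τ, hτ⟩).2, fun x hx => ?_⟩⟩
      · dsimp only
        split_ifs with hx
        exacts [hx.choose.2, h0]
      · have hx' : ∃ τ : Iio θ.ord, x ∈ P δ (q τ) := ⟨⟨τ, hτ⟩, hx⟩
        have : hx'.choose = ⟨τ, hτ⟩ := by
          by_contra hne
          have := hQd (q hx'.choose).2 (q ⟨τ, hτ⟩).2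
            fun h => hne (q.injective (Subtype.ext h))
          exact disjoint_left.1 this hx'.choose_spec hx
        simp only [mem_ofPred_eq, dif_pos hx', this]
    · exact ⟨fun _ => 0, fun _ => h0, fun h => absurd h hd⟩
  choose h h1 h2 using key
  refine hnot ⟨h, h1, fun D => ?_⟩
  obtain ⟨D', hD', hD'0⟩ := hN.directed_two hlam D D₀
  obtain ⟨δ, hδ, hX⟩ := hD₀ D' hD'0
  refine ⟨δ, fun τ hτ hnull => ?_⟩
  obtain ⟨p, hp, hsub⟩ := h2 δ (hδ.of_imp fun _ => hN.anti hD'0) τ hτ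
  have : p ∈ {p | ¬ N D' δ (P δ p)} := hX ▸ hp
  exact this ((hN.ideal D' δ).mono hsub (hN.anti hD' hnull))

/-- A form of `exists_not_hasDisjointPos` for `lam` many small families. -/
theorem exists_forall_not_hasDisjointPos (hN : IsGuessing lam N) (hlam : ℵ₀ ≤ lam)
    {θ : Cardinal.{u}} (hθ : θ ≠ 0) (hnot : ¬ Partitions N θ)
    {ι : Ordinal.{u} → Type (u + 1)} (hι : ∀ a < lam.ord, #(ι a) < Cardinal.lift.{u + 1} lam)
    (P : ∀ a, E → ι a → Set Ordinal.{u}) :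
    ∃ D, ∀ δ, ∀ a < lam.ord, ¬ HasDisjointPos (N D δ) (P a δ) θ := by
  choose D hD using fun a : Iio lam.ord =>
    hN.exists_not_hasDisjointPos hlam hθ hnot (hι a a.2) (P a)
  obtain ⟨D', hD'⟩ := hN.directed_Iio D
  exact ⟨D', fun δ a ha h => hD ⟨a, ha⟩ δ (h.of_imp fun _ => hN.anti (hD' ⟨a, ha⟩))⟩

end IsGuessing

/-! ### Successor cardinals -/

theorem exists_lt_ord_subset_Iio {lam : Cardinal.{u}} (hreg : lam.IsRegular)
    {S : Set Ordinal.{u}} (hS : S ⊆ Iio lam.ord) (hc : #S < Cardinal.lift.{u + 1} lam) :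
    ∃ a < lam.ord, S ⊆ Iio a := by
  have hlt : (⨆ i : S, (i : Ordinal.{u}) + 1) < lam.ord := by
    apply Ordinal.lift_iSup_add_one_lt_of_lt_cof _ fun i => hS i.2
    rwa [← Ordinal.lift_cof, hreg.cof_ord, Cardinal.lift_id'.{u, u + 1}]
  have : Small.{u} S := small_subset hS
  refine ⟨_, hlt, fun x hx => ?_⟩
  have := Ordinal.le_iSup (fun i : S => (i : Ordinal.{u}) + 1) ⟨x, hx⟩
  exact (Order.lt_add_one_iff.2 le_rfl).trans_le this

theorem IsNullIdeal.empty {lam : Cardinal.{u}} {I : Set Ordinal.{u} → Prop}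
    (hI : IsNullIdeal lam I) : I ∅ :=
  hI.mono (empty_subset _) hI.compl

theorem HasDisjointPos.of_family {lam : Cardinal.{u}} {I : Set Ordinal.{u} → Prop}
    (hI : IsNullIdeal lam I) {ι K : Type (u + 1)} {P : ι → Set Ordinal.{u}} {θ : Cardinal.{u}}
    (q : K → ι) (hpos : ∀ k, ¬ I (P (q k)))
    (hdisj : ∀ k l, k ≠ l → Disjoint (P (q k)) (P (q l)))
    (hcard : Cardinal.lift.{u + 1} θ ≤ #K) : HasDisjointPos I P θ := by
  have hinj : Function.Injective q := fun k l hkl => by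
    by_contra hne
    have := hdisj k l hne
    rw [← hkl, disjoint_self] at this
    exact hpos k (this ▸ hI.empty)
  refine ⟨range q, ?_, ?_, ?_⟩
  · rintro _ ⟨k, rfl⟩
    exact hpos k
  · rintro _ ⟨k, rfl⟩ _ ⟨l, rfl⟩ hne
    exact hdisj k l fun h => hne (h ▸ rfl)
  · rwa [mk_range_eq q hinj]

/-- Ulam's matrix argument. -/
theorem IsGuessing.partitions_of_succ_eq {lam θ : Cardinal.{u}} {𝒟 E : Type (u + 1)} [Preorder 𝒟]
    {N : 𝒟 → E → Set Ordinal.{u} → Prop} (hN : IsGuessing lam N) (hθ : ℵ₀ ≤ θ)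
    (hlam : Order.succ θ = lam) : Partitions N θ := by
  classical
  by_contra hnot
  have hθlam : θ < lam := hlam ▸ Order.lt_succ θ
  have hlam0 : ℵ₀ < lam := hθ.trans_lt hθlam
  have hreg : lam.IsRegular := hlam ▸ isRegular_succ hθ
  have he : ∀ α : Ordinal.{u}, ∃ e : Ordinal.{u} → Ordinal.{u}, α < lam.ord →
      (∀ j < α, e j < θ.ord) ∧ InjOn e (Iio α) := by
    intro α
    by_cases hα : α < lam.ord
    · have : #(Iio α) ≤ #(Iio θ.ord) := by
        rw [Cardinal.mk_Iio_ordinal, Cardinal.mk_Iio_ordinal, Cardinal.lift_le, card_ord]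
        rw [← hlam] at hα
        exact Order.lt_succ_iff.1 (lt_ord.1 hα)
      obtain ⟨g⟩ := this
      refine ⟨fun j => if hj : j < α then g ⟨j, hj⟩ else 0, fun _ => ⟨fun j hj => ?_, ?_⟩⟩
      · simp only [dif_pos hj]
        exact (g _).2
      · intro j (hj : j < α) k (hk : k < α) hjk
        simp only [dif_pos hj, dif_pos hk] at hjk
        exact congrArg Subtype.val (g.injective (Subtype.ext hjk))
    · exact ⟨id, fun h => absurd h hα⟩
  choose e he using he
  -- The whole matrix has `lam` many entries, too many to freeze; its restrictions to columns below
  -- `a < lam` are small enough.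
  obtain ⟨D, hD⟩ := hN.exists_forall_not_hasDisjointPos hlam0.le (aleph0_pos.trans_le hθ).ne' hnot
    (ι := fun a => Iio θ.ord × Iio a) (fun a ha => by
      rw [mk_prod, Cardinal.lift_id, Cardinal.lift_id]
      exact mul_lt_of_lt (by simpa using hlam0.le) (mk_Iio_lt (ord_lt_ord.2 hθlam))
        (mk_Iio_lt ha))
    (fun a _ p => {α | p.2 < α ∧ α < lam.ord ∧ e α p.2 = p.1})
  obtain ⟨δ, hδ⟩ := hN.exists_pos D
  have hI := hN.ideal D δ
  have hi : ∀ j : Iio lam.ord, ∃ i : Iio θ.ord,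
      ¬ N D δ {α | j < α ∧ α < lam.ord ∧ e α j = i} := by
    intro j
    by_contra! hnull
    refine hδ (hI.mono ?_ (hI.union hlam0 (hI.union hlam0
      (hI.bounded _ ((isSuccLimit_ord hlam0.le).succ_lt j.2)) hI.compl)
      (hI.iUnion _ (mk_Iio_lt (ord_lt_ord.2 hθlam)) hnull)))
    intro α _
    rcases le_or_gt α j with h | h
    · exact Or.inl (Or.inl (Order.lt_succ_iff.2 h))
    rcases le_or_gt lam.ord α with h' | h'
    · exact Or.inl (Or.inr h')
    · exact Or.inr (mem_iUnion.2 ⟨⟨e α j, (he α h').1 j h⟩, h, h', rfl⟩)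
  choose i hi using hi
  -- Each column has a positive entry, so `lam` many of these lie in one row `i₀`. Entries of one
  -- row are disjoint because `e α` is injective, and `θ` of the columns are bounded below `lam`.
  obtain ⟨i₀, hi₀⟩ := infinite_pigeonhole_card i (Cardinal.lift.{u + 1} lam)
    (by simp [Cardinal.mk_Iio_ordinal]) (by simpa using hlam0.le) (by
      rw [hreg.lift.cof_ord]
      exact mk_Iio_lt (ord_lt_ord.2 hθlam))
  obtain ⟨S, hSsub, hS⟩ := le_mk_iff_exists_subset.1
    ((Cardinal.lift_le.{u + 1}.2 hθlam.le).trans hi₀)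
  obtain ⟨a, ha, hSa⟩ := exists_lt_ord_subset_Iio hreg (S := Subtype.val '' S)
    (by rintro _ ⟨j, -, rfl⟩; exact j.2) (by
      rw [mk_image_eq Subtype.val_injective, hS, Cardinal.lift_lt]
      exact hθlam)
  refine hD δ a ha (HasDisjointPos.of_family hI (K := S)
    (fun j => (i₀, ⟨j.1, hSa ⟨j.1, j.2, rfl⟩⟩)) (fun j hj => ?_) (fun j k hjk => ?_) hS.ge)
  · refine hi j.1 ?_
    rw [show i j.1 = i₀ from hSsub j.2]
    exact hj
  · refine disjoint_left.2 fun α h1 h2 => hjk ?_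
    exact Subtype.ext (Subtype.ext ((he α h1.2.1).2 h1.1 h2.1 (h1.2.2.trans h2.2.2.symm)))

/-! ### Cones and the least θ with 2^θ ≥ lam -/

/-- The ordinals `α` for which `s` is the part of `f α` below `η`. -/
def cone (f : Ordinal.{u} → Set Ordinal.{u}) (η : Ordinal.{u}) (s : Set Ordinal.{u}) :
    Set Ordinal.{u} :=
  {α | f α ∩ Iio η = s}

/-- The remaining points of `S` below `lam` are covered by null sets, one for each of fewer than
`lam` nodes. Were the displayed set small too, `S` would be null. -/
theorem IsNullIdeal.le_mk_forall_cone_pos {lam θ : Cardinal.{u}} {I : Set Ordinal.{u} → Prop}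
    (hI : IsNullIdeal lam I) (hlam : ℵ₀ < lam)
    (hι : #(Σ η : Iio θ.ord, 𝒫 (Iio η.1)) < Cardinal.lift.{u + 1} lam)
    (f : Ordinal.{u} → Set Ordinal.{u}) {S : Set Ordinal.{u}} (hS : ¬ I S) :
    Cardinal.lift.{u + 1} lam ≤
      #{α | α ∈ S ∧ α < lam.ord ∧ ∀ η < θ.ord, ¬ I (cone f η (f α ∩ Iio η) ∩ S)} := by
  by_contra! hlt
  set R := {α | α ∈ S ∧ α < lam.ord ∧ ∀ η < θ.ord, ¬ I (cone f η (f α ∩ Iio η) ∩ S)} with hR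
  have h1 : I (⋃ a : R, {a.1}) := hI.iUnion _ hlt fun a => hI.singleton hlam.le _
  have h2 := hI.iUnion (ι := {p : Σ η : Iio θ.ord, 𝒫 (Iio η.1) // I (cone f p.1 p.2 ∩ S)})
    (fun p => cone f p.1.1 p.1.2 ∩ S) ((mk_subtype_le _).trans_lt hι) fun p => p.2
  refine hS (hI.mono ?_ (hI.union hlam (hI.union hlam h1 h2) hI.compl))
  intro α hα
  rcases le_or_gt lam.ord α with h | h
  · exact Or.inr h
  refine Or.inl ?_
  by_cases hαR : α ∈ R
  · exact Or.inl (mem_iUnion.2 ⟨⟨α, hαR⟩, rfl⟩)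
  · have : ∃ η < θ.ord, I (cone f η (f α ∩ Iio η) ∩ S) := by
      by_contra! h'
      exact hαR ⟨hα, h, h'⟩
    obtain ⟨η, hη, hnull⟩ := this
    exact Or.inr (mem_iUnion.2 ⟨⟨⟨⟨η, hη⟩, ⟨f α ∩ Iio η, inter_subset_right⟩⟩, hnull⟩, rfl, hα⟩)

theorem mk_sigma_powerset_lt {lam θ : Cardinal.{u}} (hreg : lam.IsRegular) (hθ : θ < lam)
    (hpow : ∀ μ < θ, 2 ^ μ < lam) :
    #(Σ η : Iio θ.ord, 𝒫 (Iio η.1)) < Cardinal.lift.{u + 1} lam := by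
  rw [mk_sigma]
  refine sum_lt_of_isRegular hreg.lift (mk_Iio_lt (ord_lt_ord.2 hθ)) fun η => ?_
  rw [mk_powerset, Cardinal.mk_Iio_ordinal, ← Cardinal.lift_two_power, Cardinal.lift_lt]
  exact hpow _ (lt_ord.1 η.2)

/-- If `f` is an injection of `lam` to the power set of `θ` where `2 ^ μ < lam` for all `μ < θ`,
then `θ` many of the cones of `f` are positive and pairwise disjoint. -/
theorem IsNullIdeal.hasDisjointPos_cone {lam θ : Cardinal.{u}} {I : Set Ordinal.{u} → Prop}
    (hI : IsNullIdeal lam I) (hproper : ¬ I univ) (hlam : ℵ₀ < lam) (hreg : lam.IsRegular)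
    (hθ : ℵ₀ ≤ θ) (hθlam : θ < lam) (hpow : ∀ μ < θ, 2 ^ μ < lam)
    {f : Ordinal.{u} → Set Ordinal.{u}} (hf : ∀ α, f α ⊆ Iio θ.ord)
    (hinj : InjOn f (Iio lam.ord)) :
    HasDisjointPos I (fun p : Σ η : Iio θ.ord, 𝒫 (Iio η.1) => cone f p.1 p.2) θ := by
  have hι := mk_sigma_powerset_lt hreg hθlam hpow
  have hmany := fun S => hI.le_mk_forall_cone_pos (S := S) hlam hι f
  have hlim : ∀ ξ < θ.ord, Order.succ ξ < θ.ord := fun ξ hξ => (isSuccLimit_ord hθ).succ_lt hξ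
  obtain ⟨α₀, -, hα₀, hbranch⟩ : Set.Nonempty {α | α ∈ Set.univ ∧ α < lam.ord ∧
      ∀ η < θ.ord, ¬ I (cone f η (f α ∩ Iio η) ∩ Set.univ)} := by
    rw [← nonempty_coe_sort, ← mk_ne_zero_iff]
    intro h
    have := hmany _ hproper
    rw [h, nonpos_iff_eq_zero, Cardinal.lift_eq_zero] at this
    simp [this] at hlam
  simp only [inter_univ] at hbranch
  set b := f α₀ with hb
  -- `flip ξ` consists of the `α` for which `f α` first leaves the branch `b` at `ξ`.
  let flip : Ordinal.{u} → Set Ordinal.{u} := fun ξ =>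
    {α | f α ∩ Iio ξ = b ∩ Iio ξ ∧ (ξ ∈ f α ↔ ξ ∉ b)}
  have hflip : ∀ ξ, flip ξ =
      cone f (Order.succ ξ) {x | x < ξ ∧ x ∈ b ∨ x = ξ ∧ ξ ∉ b} := by
    intro ξ
    ext α
    simp only [flip, cone, mem_ofPred_eq, Set.ext_iff, mem_inter_iff, mem_Iio, Order.lt_succ_iff]
    constructor
    · rintro ⟨h1, h2⟩ x
      have := h1 x
      rcases lt_trichotomy x ξ with h | rfl | h
      · simp only [h, h.le, h.ne] at *; tauto
      · simp [h2]
      · simp [h.not_ge, h.not_gt, h.ne']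
    · intro h
      refine ⟨fun x => ?_, ?_⟩
      · have := h x
        by_cases hx : x < ξ
        · simp only [hx, hx.le, hx.ne] at *; tauto
        · simp [hx]
      · simpa using h ξ
  have hflip_disj : ∀ ξ ξ', ξ < ξ' → Disjoint (flip ξ) (flip ξ') := by
    refine fun ξ ξ' hlt => disjoint_left.2 fun α h1 h2 => ?_
    have h3 := (Set.ext_iff.1 h2.1 ξ)
    have h4 := h1.2
    simp only [mem_inter_iff, mem_Iio, hlt, and_true] at h3
    tauto
  have hflip_disj' : ∀ ξ ξ', ξ ≠ ξ' → Disjoint (flip ξ) (flip ξ') := fun ξ ξ' hne => by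
    rcases lt_or_gt_of_ne hne with h | h
    exacts [hflip_disj _ _ h, (hflip_disj _ _ h).symm]
  let Ξ : Set Ordinal.{u} := {ξ | ξ < θ.ord ∧ ¬ I (flip ξ)}
  -- By injectivity of `f`, every `α < lam.ord` other than `α₀` leaves `b` below `θ`. If no
  -- departure from `η` on were positive, the cone of `b` at `η` would be null.
  have hcof : ∀ η < θ.ord, ∃ ξ ∈ Ξ, η ≤ ξ := by
    intro η hη
    by_contra! hcon
    refine hbranch η hη (hI.mono ?_ (hI.union hlam (hI.union hlam
      (hI.singleton hlam.le α₀) hI.compl) (hI.biUnion (ord_lt_ord.2 hθlam)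
        (X := fun ξ => {α | η ≤ ξ ∧ α ∈ flip ξ}) fun ξ hξ => ?_)))
    · intro α hα
      by_cases h1 : α = α₀
      · exact Or.inl (Or.inl h1)
      rcases le_or_gt lam.ord α with h | h
      · exact Or.inl (Or.inr h)
      have hne : ∃ ξ, ¬ (ξ ∈ f α ↔ ξ ∈ b) := by
        by_contra! h'
        exact h1 (hinj h hα₀ (Set.ext h'))
      obtain ⟨ξ, hξ, hmin⟩ := WellFounded.has_min (wellFounded_lt (α := Ordinal.{u}))
        {ξ | ¬ (ξ ∈ f α ↔ ξ ∈ b)} hne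
      have hξθ : ξ < θ.ord := by
        by_contra hge
        exact hξ ⟨fun h' => absurd (hf _ h') hge, fun h' => absurd (hf _ h') hge⟩
      refine Or.inr (mem_iUnion₂.2 ⟨ξ, hξθ, ?_, ?_, ?_⟩)
      · by_contra! hlt
        have := Set.ext_iff.1 (show f α ∩ Iio η = b ∩ Iio η from hα) ξ
        simp only [mem_inter_iff, mem_Iio, hlt, and_true] at this
        exact hξ this
      · ext x
        simp only [mem_inter_iff, mem_Iio, and_congr_left_iff]
        intro hx
        by_contra hx'
        exact hmin x hx' hx
      · have hξ' : ¬ (ξ ∈ f α ↔ ξ ∈ b) := hξ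
        tauto
    · by_cases h : η ≤ ξ
      · simp only [h, true_and, ofPred_mem_eq]
        by_contra hpos
        exact (hcon ξ ⟨hξ, hpos⟩).not_ge h
      · simpa [h] using hI.empty
  rcases le_or_gt (Cardinal.lift.{u + 1} θ) #Ξ with hΞ | hΞ
  · refine HasDisjointPos.of_family hI (K := Ξ)
      (fun ξ => ⟨⟨Order.succ ξ.1, hlim _ ξ.2.1⟩, ⟨{x | x < ξ.1 ∧ x ∈ b ∨ x = ξ.1 ∧ ξ.1 ∉ b}, ?_⟩⟩)
      (fun ξ => ?_) (fun ξ ξ' hne => ?_) hΞ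
    · rintro x (hx | hx)
      exacts [Order.lt_succ_iff.2 hx.1.le, Order.lt_succ_iff.2 hx.1.le]
    · rw [← hflip]
      exact ξ.2.2
    · rw [← hflip, ← hflip]
      exact hflip_disj' _ _ fun h => hne (Subtype.ext h)
  obtain ⟨μ, hμ⟩ := mem_range_lift_of_le hΞ.le
  have hμθ : μ < θ := by rwa [← hμ, Cardinal.lift_lt] at hΞ
  -- Now `Ξ` is cofinal but has size `μ < θ`, so the flips must be subdivided. If all levels of `Ξ`
  -- above `ξ` had at most `|ξ|` nodes positive inside `flip ξ`, then `lam` many branches would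
  -- inject into a product of size at most 2^(|ξ|·μ), which is below `lam`.
  have hwide : ∀ ξ : Ξ, ∃ η : Ξ, ξ < η ∧ Cardinal.lift.{u + 1} ξ.1.card <
      #{t | ¬ I (cone f η t ∩ flip ξ)} := by
    intro ξ
    by_contra! hcon
    have hR := hmany (flip ξ) ξ.2.2
    set R := {α | α ∈ flip ξ ∧ α < lam.ord ∧
      ∀ η < θ.ord, ¬ I (cone f η (f α ∩ Iio η) ∩ flip ξ)} with hRdef
    let g : R → ∀ η : {η : Ξ // ξ < η}, {t | ¬ I (cone f η t ∩ flip ξ)} :=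
      fun α η => ⟨f α ∩ Iio η.1.1, α.2.2.2 _ η.1.2.1⟩
    have hg : Function.Injective g := by
      intro α α' hαα'
      refine Subtype.ext (hinj α.2.2.1 α'.2.2.1 ?_)
      have key : ∀ α α' : R, g α = g α' → f α ⊆ f α' := by
        intro α α' h x hx
        have hxθ : x < θ.ord := hf _ hx
        obtain ⟨η, hη, hle⟩ := hcof _ (hlim _ (max_lt ξ.2.1 hxθ))
        have hη' := Order.succ_le_iff.1 hle
        have := congrArg Subtype.val
          (congrFun h ⟨⟨η, hη⟩, show ξ.1 < η from (le_max_left _ _).trans_lt hη'⟩)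
        have h2 : x ∈ f α' ∩ Iio η := by
          rw [← show f α ∩ Iio η = f α' ∩ Iio η from this]
          exact ⟨hx, (le_max_right _ _).trans_lt hη'⟩
        exact h2.1
      exact Subset.antisymm (key _ _ hαα') (key _ _ hαα'.symm)
    have hcard : Cardinal.lift.{u + 1} lam ≤ Cardinal.lift.{u + 1} (2 ^ (ξ.1.card * μ)) := by
      calc Cardinal.lift.{u + 1} lam ≤ #R := hR
        _ ≤ #(∀ η : {η : Ξ // ξ < η}, {t | ¬ I (cone f η t ∩ flip ξ)}) := mk_le_of_injective hg
        _ = prod fun η : {η : Ξ // ξ < η} => #{t | ¬ I (cone f η t ∩ flip ξ)} := mk_pi _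
        _ ≤ prod fun _ : {η : Ξ // ξ < η} => Cardinal.lift.{u + 1} (2 ^ ξ.1.card) :=
          prod_le_prod _ _ fun η =>
            (hcon η.1 η.2).trans (Cardinal.lift_le.2 (cantor _).le)
        _ = Cardinal.lift.{u + 1} (2 ^ ξ.1.card) ^ #{η : Ξ // ξ < η} := by simp
        _ ≤ Cardinal.lift.{u + 1} (2 ^ ξ.1.card) ^ #Ξ :=
          power_le_power_left
            (fun h => power_ne_zero _ two_ne_zero (Cardinal.lift_eq_zero.1 h))
            (mk_subtype_le _)
        _ = Cardinal.lift.{u + 1} (2 ^ (ξ.1.card * μ)) := by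
          rw [← hμ, ← Cardinal.lift_power, power_mul]
    rw [Cardinal.lift_le] at hcard
    exact hcard.not_gt (hpow _ (mul_lt_of_lt hθ (lt_ord.1 ξ.2.1) hμθ))
  choose η hη hηc using hwide
  have hne : ∀ S : Set Ordinal.{u}, ¬ I S → S.Nonempty := fun S hS => by
    by_contra h
    exact hS (not_nonempty_iff_eq_empty.1 h ▸ hI.empty)
  have hsub : ∀ (ξ : Ξ) (t : {t | ¬ I (cone f (η ξ) t ∩ flip ξ)}),
      cone f (η ξ) t ⊆ flip ξ := by
    rintro ξ ⟨t, ht⟩ α hα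
    obtain ⟨α', hα', hα'2⟩ := hne _ ht
    have heq : f α ∩ Iio (η ξ).1 = f α' ∩ Iio (η ξ).1 := Eq.trans hα (Eq.symm hα')
    have hmem : ∀ x ≤ ξ.1, x ∈ f α ↔ x ∈ f α' := fun x hx => by
      have := Set.ext_iff.1 heq x
      simpa [show x < (η ξ).1 from hx.trans_lt (hη ξ)] using this
    refine ⟨?_, (hmem _ le_rfl).trans hα'2.2⟩
    rw [← hα'2.1]
    ext x
    simp only [mem_inter_iff, mem_Iio, and_congr_left_iff]
    exact fun hx => hmem x hx.le
  refine HasDisjointPos.of_family hI (K := Σ ξ : Ξ, {t | ¬ I (cone f (η ξ) t ∩ flip ξ)})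
    (fun p => ⟨⟨(η p.1).1, (η p.1).2.1⟩, ⟨p.2.1, ?_⟩⟩) (fun p hp => ?_) (fun p p' hpp' => ?_) ?_
  · obtain ⟨α, hα, -⟩ := hne _ p.2.2
    rw [← show f α ∩ Iio (η p.1).1 = p.2.1 from hα]
    exact inter_subset_right
  · exact p.2.2 (hI.mono inter_subset_left hp)
  · obtain ⟨ξ, t⟩ := p
    obtain ⟨ξ', t'⟩ := p'
    by_cases hξ : ξ = ξ'
    · subst hξ
      refine disjoint_left.2 fun α h1 h2 => hpp' ?_
      have : t = t' := Subtype.ext (Eq.trans (Eq.symm h1) h2)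
      rw [this]
    · exact (hflip_disj' _ _ fun h => hξ (Subtype.ext h)).mono (hsub _ t) (hsub _ t')
  -- If only `m < θ` sets were collected, take `ξ ∈ Ξ` above `m.ord`: its flip alone contributes
  -- more than `|ξ| ≥ m`.
  · by_contra! hlt
    obtain ⟨m, hm⟩ := mem_range_lift_of_le hlt.le
    rw [← hm, Cardinal.lift_lt] at hlt
    obtain ⟨ξ, hξ, hle⟩ := hcof _ (ord_lt_ord.2 hlt)
    have h1 := hηc ⟨ξ, hξ⟩
    have h2 : #{t | ¬ I (cone f (η ⟨ξ, hξ⟩) t ∩ flip ξ)} ≤ Cardinal.lift.{u + 1} m := by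
      rw [hm]
      exact mk_le_of_injective (f := fun t => (⟨⟨ξ, hξ⟩, t⟩ :
        Σ ξ : Ξ, {t | ¬ I (cone f (η ξ) t ∩ flip ξ)})) fun t t' h => by simpa using h
    have h3 := h1.trans_le h2
    rw [Cardinal.lift_lt] at h3
    exact h3.not_ge (by simpa using Ordinal.card_le_card hle)

theorem IsGuessing.partitions_of_isLeast {lam θ : Cardinal.{u}} {𝒟 E : Type (u + 1)} [Preorder 𝒟]
    {N : 𝒟 → E → Set Ordinal.{u} → Prop} (hN : IsGuessing lam N) (hlam : ℵ₀ < lam)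
    (hreg : lam.IsRegular) (hθ : ℵ₀ ≤ θ) (hθlam : θ < lam)
    (hleast : IsLeast {μ : Cardinal.{u} | lam ≤ 2 ^ μ} θ) : Partitions N θ := by
  classical
  by_contra hnot
  have hpow : ∀ μ < θ, 2 ^ μ < lam := fun μ hμ => by
    by_contra! h
    exact (hleast.2 h).not_gt hμ
  have : #(Iio lam.ord) ≤ #(𝒫 (Iio θ.ord)) := by
    rw [mk_powerset, Cardinal.mk_Iio_ordinal, Cardinal.mk_Iio_ordinal,
      ← Cardinal.lift_two_power, Cardinal.lift_le, card_ord, card_ord]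
    exact hleast.1
  obtain ⟨g⟩ := this
  let f : Ordinal.{u} → Set Ordinal.{u} := fun α => if h : α < lam.ord then g ⟨α, h⟩ else ∅
  obtain ⟨D, hD⟩ := hN.exists_not_hasDisjointPos hlam.le (aleph0_pos.trans_le hθ).ne' hnot
    (mk_sigma_powerset_lt hreg hθlam hpow) (fun _ p => cone f p.1 p.2)
  obtain ⟨δ, hδ⟩ := hN.exists_pos D
  refine hD δ ((hN.ideal D δ).hasDisjointPos_cone hδ hlam hreg hθ hθlam hpow ?_ ?_)
  · intro α
    by_cases h : α < lam.ord
    · simp only [f, dif_pos h]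
      exact (g ⟨α, h⟩).2
    · simp [f, h]
  · intro α (h : α < lam.ord) α' (h' : α' < lam.ord) heq
    simp only [f, dif_pos h, dif_pos h'] at heq
    exact congrArg Subtype.val (g.injective (Subtype.ext heq))

/-! ### Clubs and pressing down -/

theorem IsClubIn.isLUB_mem {C s : Set Ordinal.{u}} {δ a : Ordinal.{u}} (hC : IsClubIn C δ)
    (hs : s ⊆ C) (hne : s.Nonempty) (ha : IsLUB s a) (haδ : a < δ) : a ∈ C := by
  refine hC.2.isLUB_mem (t := {x : Iio δ | x.1 ∈ s}) (x := ⟨a, haδ⟩) (fun x hx => hs hx) ?_ ?_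
  · obtain ⟨x, hx⟩ := hne
    exact ⟨⟨x, hC.1 (hs hx)⟩, hx⟩
  · exact ⟨fun x hx => ha.1 hx, fun y hy => ha.2 fun x hx =>
      show x ≤ y.1 from hy (show (⟨x, hC.1 (hs hx)⟩ : Iio δ) ∈ {x : Iio δ | x.1 ∈ s} from hx)⟩

theorem IsClubIn.exists_ge {C : Set Ordinal.{u}} {δ a : Ordinal.{u}} (hC : IsClubIn C δ)
    (ha : a < δ) : ∃ c ∈ C, a ≤ c := by
  obtain ⟨c, hc, hle⟩ := hC.2.isCofinal ⟨a, ha⟩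
  exact ⟨c, hc, hle⟩

/-- The factor `Iio κ.ord` matters only for the empty family, whose intersection is everything. -/
theorem IsClubIn.inter_iInter {κ : Cardinal.{u}} (hκ : κ.IsRegular) (hκ0 : ℵ₀ < κ)
    {ι : Type (u + 1)} (hι : #ι < Cardinal.lift.{u + 1} κ) {C : ι → Set Ordinal.{u}}
    (hC : ∀ i, IsClubIn (C i) κ.ord) : IsClubIn (Iio κ.ord ∩ ⋂ i, C i) κ.ord := by
  refine ⟨inter_subset_left, ?_⟩
  have hcof : Order.cof (Iio κ.ord) = Cardinal.lift.{u + 1} κ := by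
    rw [cof_Iio, ← Ordinal.lift_cof, hκ.cof_ord]
  have h := IsClub.iInter (f := fun i => {x : Iio κ.ord | x.1 ∈ C i})
    (by rw [hcof]; exact (by simpa using hκ0 : ℵ₀ < Cardinal.lift.{u + 1} κ).ne')
    (by rwa [hcof, Cardinal.lift_id, Cardinal.lift_id]) fun i => (hC i).2
  convert h using 1
  ext x
  simp

/-- Almost all values of `Δ` are below `lam`, but not below any fixed member of `lam`. -/
structure IsDivergent (lam : Cardinal.{u}) (I : Set Ordinal.{u} → Prop)
    (Δ : Ordinal.{u} → Ordinal.{u}) : Prop where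
  small : ∀ η < lam.ord, I {x | Δ x < η}
  large : I {x | lam.ord ≤ Δ x}

/-- A divergent function can be decreased to another one outside of any club. -/
theorem IsNullIdeal.exists_divergent_lt {lam : Cardinal.{u}} {I : Set Ordinal.{u} → Prop}
    (hI : IsNullIdeal lam I) (hlam : ℵ₀ < lam) {Δ : Ordinal.{u} → Ordinal.{u}}
    (hΔ : IsDivergent lam I Δ) {C : Set Ordinal.{u}} (hC : IsClubIn C lam.ord)
    (ψ : Ordinal.{u} → Ordinal.{u}) (hlt : ∀ x, Δ x ∈ C → ψ x < Δ x)
    (hψ : ∀ η < lam.ord, I {x | Δ x ∈ C ∧ ψ x < η}) :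
    ∃ Δ', IsDivergent lam I Δ' ∧ I {x | Δ x ≤ Δ' x} := by
  classical
  -- Off `C`, closedness makes the supremum strictly smaller than `Δ x`, except on the null sets
  -- where `Δ x` is 0 (the empty supremum is 0) or at least `lam.ord`.
  let Δ' : Ordinal.{u} → Ordinal.{u} := fun x =>
    if Δ x ∈ C then ψ x else sSup (C ∩ Iio (Δ x))
  have hlim := isSuccLimit_ord hlam.le
  have hbdd : ∀ x, BddAbove (C ∩ Iio (Δ x)) := fun x => ⟨Δ x, fun y hy => hy.2.le⟩
  have hle : I {x | Δ x ≤ Δ' x} := by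
    refine hI.mono ?_ (hI.union hlam (hΔ.small 1
      (by rw [lt_ord, card_one]; exact one_lt_aleph0.trans hlam)) hΔ.large)
    intro x (hx : Δ x ≤ Δ' x)
    by_contra hcon
    simp only [mem_union, mem_ofPred_eq, not_or, not_lt, not_le] at hcon
    obtain ⟨h1, h2⟩ := hcon
    by_cases hxC : Δ x ∈ C
    · simp only [Δ', if_pos hxC] at hx
      exact hx.not_gt (hlt x hxC)
    · simp only [Δ', if_neg hxC] at hx
      have hne : (C ∩ Iio (Δ x)).Nonempty := by
        by_contra hemp
        rw [not_nonempty_iff_eq_empty.1 hemp, csSup_empty] at hx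
        exact (h1.trans hx).not_gt (by simp)
      have heq : sSup (C ∩ Iio (Δ x)) = Δ x :=
        (csSup_le hne fun y hy => hy.2.le).antisymm hx
      have hlub := isLUB_csSup hne (hbdd x)
      rw [heq] at hlub
      exact hxC (hC.isLUB_mem inter_subset_left hne hlub h2)
  refine ⟨Δ', ⟨fun η hη => ?_, ?_⟩, hle⟩
  · obtain ⟨e, he, hηe⟩ := hC.exists_ge hη
    refine hI.mono ?_ (hI.union hlam (hψ η hη) (hΔ.small _ (hlim.succ_lt (hC.1 he))))
    intro x (hx : Δ' x < η)
    by_cases hxC : Δ x ∈ C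
    · simp only [Δ', if_pos hxC] at hx
      exact Or.inl ⟨hxC, hx⟩
    · simp only [Δ', if_neg hxC] at hx
      refine Or.inr (show Δ x < Order.succ e from Order.lt_succ_iff.2 ?_)
      by_contra! hlt'
      exact (hηe.trans (le_csSup (hbdd x) ⟨he, hlt'⟩)).not_gt hx
  · refine hI.mono ?_ (hI.union hlam hle hΔ.large)
    intro x (hx : lam.ord ≤ Δ' x)
    rcases le_total (Δ x) (Δ' x) with h | h
    · exact Or.inl h
    · exact Or.inr (hx.trans h)

namespace IsGuessing

variable {lam : Cardinal.{u}} {𝒟 E : Type (u + 1)} [Preorder 𝒟]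
  {N : 𝒟 → E → Set Ordinal.{u} → Prop}

/-- Divergent functions cannot be decreased again and again. -/
theorem false_of_descent (hN : IsGuessing lam N) (hlam : ℵ₀ < lam)
    (step : ∀ (D : 𝒟) (Δ : E → Ordinal.{u} → Ordinal.{u}),
      (∀ δ, IsDivergent lam (N D δ) (Δ δ)) →
      ∃ D' ≤ D, ∀ δ, ∃ Δ', IsDivergent lam (N D' δ) Δ' ∧ N D' δ {x | Δ δ x ≤ Δ' x}) : False := by
  -- The empty family serves only to produce an element of `𝒟`.
  obtain ⟨D₀, -⟩ := hN.directed (ι := PEmpty) PEmpty.elim (by simp)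
  let State := {p : 𝒟 × (E → Ordinal.{u} → Ordinal.{u}) // ∀ δ, IsDivergent lam (N p.1 δ) (p.2 δ)}
  have step' : ∀ p : State, ∃ q : State, q.1.1 ≤ p.1.1 ∧
      ∀ δ, N q.1.1 δ {x | p.1.2 δ x ≤ q.1.2 δ x} := by
    intro p
    obtain ⟨D', hD', h⟩ := step p.1.1 p.1.2 p.2
    choose Δ' h1 h2 using h
    exact ⟨⟨(D', Δ'), h1⟩, hD', h2⟩
  choose next hnext hnext' using step'
  let s₀ : State := ⟨(D₀, fun _ x => x), fun δ =>
    ⟨(hN.ideal D₀ δ).bounded, (hN.ideal D₀ δ).compl⟩⟩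
  let s : ℕ → State := fun n => next^[n] s₀
  have hs : ∀ n, s (n + 1) = next (s n) := fun n => Function.iterate_succ_apply' next n s₀
  obtain ⟨D, hD⟩ := hN.directed_nat hlam.le fun n => (s n).1.1
  obtain ⟨δ, hδ⟩ := hN.exists_pos D
  have hnull := (hN.ideal D δ).iUnion_nat hlam
    (X := fun n => {x | (s n).1.2 δ x ≤ (s (n + 1)).1.2 δ x}) fun n => by
      refine hN.anti (hD (n + 1)) ?_
      rw [hs]
      exact hnext' (s n) δ
  have : ∃ x, ∀ n, (s (n + 1)).1.2 δ x < (s n).1.2 δ x := by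
    by_contra! hcon
    refine hδ ((hN.ideal D δ).mono (fun x _ => ?_) hnull)
    obtain ⟨n, hn⟩ := hcon x
    exact mem_iUnion.2 ⟨n, hn⟩
  obtain ⟨x, hx⟩ := this
  obtain ⟨_, ⟨n, rfl⟩, hmin⟩ := WellFounded.has_min (wellFounded_lt (α := Ordinal.{u}))
    (range fun n => (s n).1.2 δ x) (range_nonempty _)
  exact hmin _ ⟨n + 1, rfl⟩ (hx n)

/-- The colour `φ i β` is read off from the `i`-th set in `𝒜 β`. If each colouring `φ i (Δ δ x)` has
a null class `f i`, the coded graph of `f` is guessed on a club. There some index `i < Δ δ x` names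
the guess, which forces `φ i (Δ δ x) = f i` once the code of `(i, f i)` lies below `Δ δ x`. So the
index is a smaller divergent function. -/
theorem partitions_of_diamondStar (hN : IsGuessing lam N) (hlam : ℵ₀ < lam)
    (hdia : DiamondStar lam) : Partitions N lam := by
  classical
  by_contra hnot
  obtain ⟨𝒜, h𝒜, hguess⟩ := hdia
  have h0 : 0 < lam.ord := (isSuccLimit_ord hlam.le).bot_lt
  have hpr : ∃ pr : Ordinal.{u} → Ordinal.{u} → Ordinal.{u},
      (∀ i < lam.ord, ∀ j < lam.ord, pr i j < lam.ord) ∧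
      ∀ i < lam.ord, ∀ j < lam.ord, ∀ i' < lam.ord, ∀ j' < lam.ord,
        pr i j = pr i' j' → i = i' ∧ j = j' := by
    have : #(Iio lam.ord × Iio lam.ord) ≤ #(Iio lam.ord) := by
      rw [mk_prod, Cardinal.lift_id, Cardinal.mk_Iio_ordinal, card_ord,
        mul_eq_self (by simpa using hlam.le)]
    obtain ⟨g⟩ := this
    refine ⟨fun i j => if h : i < lam.ord ∧ j < lam.ord then g (⟨i, h.1⟩, ⟨j, h.2⟩) else 0,
      fun i hi j hj => ?_, fun i hi j hj i' hi' j' hj' h => ?_⟩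
    · simp only [dif_pos (And.intro hi hj)]
      exact (g _).2
    · simp only [dif_pos (And.intro hi hj), dif_pos (And.intro hi' hj')] at h
      have := g.injective (Subtype.ext h)
      exact ⟨congrArg (fun p => p.1.1) this, congrArg (fun p => p.2.1) this⟩
  obtain ⟨pr, hpr, hprinj⟩ := hpr
  have henum : ∀ β : Ordinal.{u}, ∃ e : Ordinal.{u} → Set Ordinal.{u},
      β < lam.ord → ∀ A ∈ 𝒜 β, ∃ i < β, e i = A := by
    intro β
    by_cases hβ : β < lam.ord
    · have := (h𝒜 β hβ).2
      rw [← Cardinal.mk_Iio_ordinal] at this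
      obtain ⟨g⟩ := this
      refine ⟨fun i => if h : ∃ A : 𝒜 β, (g A).1 = i then h.choose else ∅, fun _ A hA =>
        ⟨g ⟨A, hA⟩, (g ⟨A, hA⟩).2, ?_⟩⟩
      have h : ∃ A' : 𝒜 β, (g A').1 = g ⟨A, hA⟩ := ⟨_, rfl⟩
      have := g.injective (Subtype.ext h.choose_spec)
      simp only [dif_pos h, this]
    · exact ⟨fun _ => ∅, fun h => absurd h hβ⟩
  choose e he using henum
  let φ : Ordinal.{u} → Ordinal.{u} → Ordinal.{u} := fun i β =>
    if h : ∃ τ < lam.ord, pr i τ ∈ e β i then h.choose else 0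
  have hφ : ∀ i β, φ i β < lam.ord := by
    intro i β
    simp only [φ]
    split_ifs with h
    exacts [h.choose_spec.1, h0]
  refine hN.false_of_descent hlam fun D Δ hΔ => ?_
  have hfail : ∀ i : Iio lam.ord, ∃ D', ∀ δ, ∃ τ < lam.ord, N D' δ {x | φ i (Δ δ x) = τ} := by
    intro i
    by_contra! hcon
    exact hnot ⟨fun δ x => φ i (Δ δ x), fun δ x => hφ _ _, hcon⟩
  choose Df hDf using hfail
  obtain ⟨D₁, hD₁⟩ := hN.directed_Iio Df
  obtain ⟨D', hD'1, hD'⟩ := hN.directed_two hlam.le D₁ D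
  refine ⟨D', hD', fun δ => ?_⟩
  have hI := hN.ideal D' δ
  have hfex : ∃ f : Ordinal.{u} → Ordinal.{u}, ∀ i < lam.ord, f i < lam.ord ∧
      N D' δ {x | φ i (Δ δ x) = f i} := by
    have : ∀ i, ∃ τ, i < lam.ord → τ < lam.ord ∧ N D' δ {x | φ i (Δ δ x) = τ} := by
      intro i
      by_cases hi : i < lam.ord
      · obtain ⟨τ, hτ, h⟩ := hDf ⟨i, hi⟩ δ
        exact ⟨τ, fun _ => ⟨hτ, hN.anti (hD'1.trans (hD₁ _)) h⟩⟩
      · exact ⟨0, fun h => absurd h hi⟩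
    choose f hf using this
    exact ⟨f, hf⟩
  obtain ⟨f, hf⟩ := hfex
  have hΔ' : IsDivergent lam (N D' δ) (Δ δ) :=
    ⟨fun η hη => hN.anti hD' ((hΔ δ).small η hη), hN.anti hD' (hΔ δ).large⟩
  obtain ⟨C, hC, hCg⟩ := hguess {y | ∃ i < lam.ord, y = pr i (f i)} (by
    rintro _ ⟨i, hi, rfl⟩
    exact hpr i hi _ (hf i hi).1)
  set A := {y | ∃ i < lam.ord, y = pr i (f i)} with hA
  have hex : ∀ x, Δ δ x ∈ C → ∃ i < Δ δ x, e (Δ δ x) i = A ∩ Iio (Δ δ x) := fun x hx =>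
    he _ (hC.1 hx) _ (hCg _ hx)
  let ψ : Ordinal.{u} → Ordinal.{u} := fun x =>
    if h : ∃ i < Δ δ x, e (Δ δ x) i = A ∩ Iio (Δ δ x) then h.choose else 0
  have hψ : ∀ x, Δ δ x ∈ C → ψ x < Δ δ x ∧ e (Δ δ x) (ψ x) = A ∩ Iio (Δ δ x) := by
    intro x hx
    simp only [ψ, dif_pos (hex x hx)]
    exact (hex x hx).choose_spec
  refine hI.exists_divergent_lt hlam hΔ' hC ψ (fun x hx => (hψ x hx).1) fun η hη => ?_
  refine hI.mono ?_ (hI.biUnion hη (X := fun i => {x | φ i (Δ δ x) = f i} ∪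
    {x | Δ δ x < Order.succ (pr i (f i))}) fun i hi => ?_)
  · rintro x ⟨hxC, hxη⟩
    refine mem_iUnion₂.2 ⟨ψ x, hxη, ?_⟩
    obtain ⟨h1, h2⟩ := hψ x hxC
    have hi := h1.trans (hC.1 hxC)
    by_cases hlt : pr (ψ x) (f (ψ x)) < Δ δ x
    · have hmem : ∃ τ < lam.ord, pr (ψ x) τ ∈ e (Δ δ x) (ψ x) :=
        ⟨f (ψ x), (hf _ hi).1, h2 ▸ ⟨⟨_, hi, rfl⟩, hlt⟩⟩
      -- The guess is part of the graph of a function, so the decoded colour can only be `f (ψ x)`.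
      obtain ⟨h3, h4⟩ := hmem.choose_spec
      obtain ⟨⟨i', hi', heq⟩, -⟩ := h2.subset h4
      obtain ⟨h5, h6⟩ := hprinj _ hi _ h3 _ hi' _ (hf i' hi').1 heq
      refine Or.inl ?_
      simp only [φ, mem_ofPred_eq, dif_pos hmem]
      rw [h6, ← h5]
    · exact Or.inr (Order.lt_succ_iff.2 (not_lt.1 hlt))
  · have hi' := hi.trans hη
    exact hI.union hlam (hf i hi').2
      (hΔ'.small _ ((isSuccLimit_ord hlam.le).succ_lt (hpr _ hi' _ (hf i hi').1)))

end IsGuessing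

/-! ### Trees with finite levels and ineffability -/

section Tree

variable {lam : Cardinal.{u}} {I : Set Ordinal.{u} → Prop}

theorem mk_powerset_Iio_lt (hpow : ∀ μ < lam, 2 ^ μ < lam) {a : Ordinal.{u}} (ha : a < lam.ord) :
    #(𝒫 (Iio a)) < Cardinal.lift.{u + 1} lam := by
  rw [mk_powerset, Cardinal.mk_Iio_ordinal, ← Cardinal.lift_two_power, Cardinal.lift_lt]
  exact hpow _ (lt_ord.1 ha)

/-- The nodes of height `a` with a positive cone. -/
def posLevel (I : Set Ordinal.{u} → Prop) (f : Ordinal.{u} → Set Ordinal.{u})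
    (a : Ordinal.{u}) : Set (Set Ordinal.{u}) :=
  {s | s ⊆ Iio a ∧ ¬ I (cone f a s)}

theorem IsNullIdeal.exists_extension (hI : IsNullIdeal lam I) (hpow : ∀ μ < lam, 2 ^ μ < lam)
    {f : Ordinal.{u} → Set Ordinal.{u}} {a a' : Ordinal.{u}} (haa' : a ≤ a') (ha' : a' < lam.ord)
    {s S : Set Ordinal.{u}} (hs : ¬ I (cone f a s ∩ S)) :
    ∃ s' ⊆ Iio a', s' ∩ Iio a = s ∧ ¬ I (cone f a' s' ∩ S) := by
  by_contra! hcon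
  refine hs (hI.mono ?_ (hI.iUnion
    (fun s' : {s' : 𝒫 (Iio a') // s'.1 ∩ Iio a = s} => cone f a' s'.1 ∩ S)
    ((mk_subtype_le _).trans_lt (mk_powerset_Iio_lt hpow ha')) fun s' => hcon _ s'.1.2 s'.2))
  rintro x ⟨hx, hxS⟩
  refine mem_iUnion.2 ⟨⟨⟨f x ∩ Iio a', inter_subset_right⟩, ?_⟩, rfl, hxS⟩
  rw [← show f x ∩ Iio a = s from hx]
  ext y
  simp only [mem_inter_iff, mem_Iio]
  exact ⟨fun h => ⟨h.1.1, h.2⟩, fun h => ⟨⟨h.1, h.2.trans_le haa'⟩, h.2⟩⟩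

/-- Cones of distinct nodes of the same height are disjoint. -/
theorem finite_posLevel {f : Ordinal.{u} → Set Ordinal.{u}} {a : Ordinal.{u}}
    (h : ¬ HasDisjointPos I (fun s : 𝒫 (Iio a) => cone f a s) ℵ₀) : (posLevel I f a).Finite := by
  by_contra hinf
  have hinf' : (posLevel I f a).Infinite := hinf
  refine h ⟨{s | s.1 ∈ posLevel I f a}, fun s hs => hs.2, ?_, ?_⟩
  · intro s _ t _ hst
    exact disjoint_left.2 fun x hx hx' => hst (Subtype.ext (Eq.trans (Eq.symm hx) hx'))
  · rw [Cardinal.lift_aleph0, aleph0_le_mk_iff, infinite_coe_iff]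
    refine Set.Infinite.of_image Subtype.val (hinf'.mono fun s hs => ?_)
    exact ⟨⟨s, hs.1⟩, hs, rfl⟩

/-- If all levels of the tree of positive cones are finite, then
no node splits beyond a certain height. -/
theorem IsNullIdeal.exists_forall_not_split (hI : IsNullIdeal lam I) (hlam : ℵ₀ < lam)
    (hreg : lam.IsRegular) (hpow : ∀ μ < lam, 2 ^ μ < lam) {f : Ordinal.{u} → Set Ordinal.{u}}
    (hfin : ∀ a < lam.ord, (posLevel I f a).Finite) :
    ∃ η < lam.ord, ∀ s ⊆ Iio η, ∀ ξ < lam.ord,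
      I (cone f η s ∩ {x | ξ ∈ f x}) ∨ I (cone f η s ∩ {x | ξ ∉ f x}) := by
  by_contra! hcon
  have hlim := isSuccLimit_ord hlam.le
  have hmono : ∀ a a', a ≤ a' → a' < lam.ord →
      posLevel I f a ⊆ (fun s' => s' ∩ Iio a) '' posLevel I f a' := by
    rintro a a' haa' ha' s ⟨-, hs⟩
    obtain ⟨s', h1, h2, h3⟩ := hI.exists_extension hpow haa' ha' (S := Set.univ)
      (by simpa using hs)
    exact ⟨s', ⟨h1, by simpa using h3⟩, h2⟩
  have hmono' : ∀ a a', a ≤ a' → a' < lam.ord →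
      (posLevel I f a).ncard ≤ (posLevel I f a').ncard := fun a a' haa' ha' =>
    (ncard_le_ncard (hmono a a' haa' ha') ((hfin a' ha').image _)).trans
      (ncard_image_le (hfin a' ha'))
  -- Positive nodes extend to positive nodes at all greater heights, so each split adds a node to
  -- some later level.
  have hgrow : ∀ n : ℕ, ∃ a < lam.ord, n ≤ (posLevel I f a).ncard := by
    intro n
    induction n with
    | zero => exact ⟨0, hlim.bot_lt, Nat.zero_le _⟩
    | succ n ih =>
      obtain ⟨a, ha, hn⟩ := ih
      obtain ⟨s, hs, ξ, hξ, hp, hp'⟩ := hcon a ha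
      have ha' := hlim.succ_lt (max_lt ha hξ)
      have haa' : a ≤ Order.succ (max a ξ) := (le_max_left _ _).trans (Order.le_succ _)
      have hξa' : ξ < Order.succ (max a ξ) := Order.lt_succ_iff.2 (le_max_right _ _)
      obtain ⟨s₁, h1, h2, h3⟩ := hI.exists_extension hpow haa' ha' hp
      obtain ⟨s₂, k1, k2, k3⟩ := hI.exists_extension hpow haa' ha' hp'
      have hne : s₂ ≠ s₁ := by
        rintro rfl
        by_cases hmem : ξ ∈ s₂
        · refine k3 (hI.mono ?_ hI.empty)
          rintro x ⟨hx, hx'⟩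
          rw [← show f x ∩ _ = s₂ from hx] at hmem
          exact hx' hmem.1
        · refine h3 (hI.mono ?_ hI.empty)
          rintro x ⟨hx, hx'⟩
          rw [← show f x ∩ _ = s₂ from hx] at hmem
          exact hmem ⟨hx', hξa'⟩
      have hs₁ : s₁ ∈ posLevel I f (Order.succ (max a ξ)) :=
        ⟨h1, fun h => h3 (hI.mono inter_subset_left h)⟩
      have hs₂ : s₂ ∈ posLevel I f (Order.succ (max a ξ)) :=
        ⟨k1, fun h => k3 (hI.mono inter_subset_left h)⟩
      have hsub : posLevel I f a ⊆
          (fun s' => s' ∩ Iio a) '' (posLevel I f (Order.succ (max a ξ)) \ {s₁}) := by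
        intro t ht
        obtain ⟨t', ht', rfl⟩ := hmono a _ haa' ha' ht
        by_cases h : t' = s₁
        · subst h
          exact ⟨s₂, ⟨hs₂, hne⟩, k2.trans h2.symm⟩
        · exact ⟨t', ⟨ht', h⟩, rfl⟩
      refine ⟨_, ha', ?_⟩
      have hf' := hfin _ ha'
      calc n + 1 ≤ (posLevel I f a).ncard + 1 := Nat.succ_le_succ hn
        _ ≤ (posLevel I f (Order.succ (max a ξ)) \ {s₁}).ncard + 1 :=
          Nat.succ_le_succ ((ncard_le_ncard hsub (hf'.sdiff.image _)).trans
            (ncard_image_le hf'.sdiff))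
        _ = _ := ncard_sdiff_singleton_add_one hs₁ hf'
  -- As `lam` is regular and uncountable, one `b < lam` lies above all `a n`; its finite level would
  -- have at least `n` nodes for every `n`.
  choose a ha hn using hgrow
  obtain ⟨b, hb, hab⟩ := exists_lt_ord_subset_Iio hreg (S := range a)
    (by rintro _ ⟨n, rfl⟩; exact ha n) (by
      refine lt_of_le_of_lt (mk_le_aleph0_iff.2 (countable_range a).to_subtype) ?_
      simpa using hlam)
  have := hn ((posLevel I f b).ncard + 1)
  exact absurd (this.trans (hmono' _ b (hab ⟨_, rfl⟩).le hb)) (by simp)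

end Tree

/-- Without a partition, the tree of the sets `A (Δ δ x)` stops splitting at some height `η`. Each
node `s` of that height then determines a set `b s` agreeing at any given point with almost all sets
through `s`. A single club avoids the guesses of all `b s`, and the first difference `ψ x` is a
smaller divergent function. -/
theorem IsGuessing.partitions_of_not_isIneffable {lam : Cardinal.{u}} {𝒟 E : Type (u + 1)}
    [Preorder 𝒟] {N : 𝒟 → E → Set Ordinal.{u} → Prop} (hN : IsGuessing lam N) (hlam : ℵ₀ < lam)
    (hreg : lam.IsRegular) (hpow : ∀ μ < lam, 2 ^ μ < lam) (hineff : ¬ IsIneffable lam) :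
    Partitions N ℵ₀ := by
  by_contra hnot
  have hA : ∃ A : Ordinal.{u} → Set Ordinal.{u}, (∀ α < lam.ord, A α ⊆ Iio α) ∧
      ∀ B ⊆ Iio lam.ord, ∃ C, IsClubIn C lam.ord ∧ ∀ α ∈ C, B ∩ Iio α ≠ A α := by
    simp only [IsIneffable, not_and, not_forall, not_exists] at hineff
    obtain ⟨A, hA, hB⟩ := hineff hlam hreg
    refine ⟨A, hA, fun B hBsub => ?_⟩
    obtain ⟨t, ht, htd⟩ := not_isStationary_iff.1 (hB B hBsub)
    refine ⟨Subtype.val '' t, ⟨?_, ?_⟩, ?_⟩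
    · rintro _ ⟨x, -, rfl⟩
      exact x.2
    · convert ht using 1
      ext x
      exact ⟨fun ⟨y, hy, h⟩ => Subtype.ext h ▸ hy, fun h => ⟨x, h, rfl⟩⟩
    · rintro _ ⟨x, hx, rfl⟩ heq
      exact disjoint_left.1 htd (show x ∈ {α : Iio lam.ord | B ∩ Iio α.1 = A α} from heq) hx
  obtain ⟨A, hAsub, hA⟩ := hA
  refine hN.false_of_descent hlam fun D Δ hΔ => ?_
  obtain ⟨D₁, hD₁⟩ := hN.exists_forall_not_hasDisjointPos hlam.le aleph0_ne_zero hnot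
    (ι := fun a => 𝒫 (Iio a)) (fun a ha => mk_powerset_Iio_lt hpow ha)
    (fun a δ s => cone (fun x => A (Δ δ x)) a s)
  obtain ⟨D', hD'1, hD'⟩ := hN.directed_two hlam.le D₁ D
  refine ⟨D', hD', fun δ => ?_⟩
  have hI := hN.ideal D' δ
  have hΔ' : IsDivergent lam (N D' δ) (Δ δ) :=
    ⟨fun η hη => hN.anti hD' ((hΔ δ).small η hη), hN.anti hD' (hΔ δ).large⟩
  set f : Ordinal.{u} → Set Ordinal.{u} := fun x => A (Δ δ x) with hf
  obtain ⟨η, hη, hsplit⟩ := hI.exists_forall_not_split hlam hreg hpow (f := f)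
    fun a ha => finite_posLevel fun h => hD₁ δ a ha (h.of_imp fun _ => hN.anti hD'1)
  let b : Set Ordinal.{u} → Set Ordinal.{u} := fun s =>
    {ξ | ξ < lam.ord ∧ ¬ N D' δ (cone f η s ∩ {x | ξ ∈ f x})}
  choose C hC hCne using fun s => hA (b s) fun ξ hξ => hξ.1
  have hclub := IsClubIn.inter_iInter hreg hlam (mk_powerset_Iio_lt hpow hη)
    (C := fun s : 𝒫 (Iio η) => C s) fun s => hC s
  let ψ : Ordinal.{u} → Ordinal.{u} := fun x =>
    sInf {ξ | ¬ (ξ ∈ f x ↔ ξ ∈ b (f x ∩ Iio η))}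
  have hψ : ∀ x, Δ δ x ∈ Iio lam.ord ∩ ⋂ s : 𝒫 (Iio η), C s →
      ψ x < Δ δ x ∧ ¬ (ψ x ∈ f x ↔ ψ x ∈ b (f x ∩ Iio η)) := by
    rintro x ⟨hx, hxC⟩
    have hne := hCne (f x ∩ Iio η) _ (mem_iInter.1 hxC ⟨f x ∩ Iio η, inter_subset_right⟩)
    have : ∃ ξ < Δ δ x, ¬ (ξ ∈ f x ↔ ξ ∈ b (f x ∩ Iio η)) := by
      by_contra! hcon
      refine hne ?_
      ext ξ
      refine ⟨fun h => (hcon ξ h.2).2 h.1, fun h => ?_⟩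
      have hlt := hAsub _ hx h
      exact ⟨(hcon ξ hlt).1 h, hlt⟩
    obtain ⟨ξ, hξ, hξ'⟩ := this
    exact ⟨(csInf_le' (s := {ξ | ¬ (ξ ∈ f x ↔ ξ ∈ b (f x ∩ Iio η))}) hξ').trans_lt hξ,
      csInf_mem (s := {ξ | ¬ (ξ ∈ f x ↔ ξ ∈ b (f x ∩ Iio η))}) ⟨ξ, hξ'⟩⟩
  refine hI.exists_divergent_lt hlam hΔ' hclub ψ (fun x hx => (hψ x hx).1) fun ζ hζ => ?_
  refine hI.mono ?_ (hI.iUnion (fun s : 𝒫 (Iio η) => ⋃ ξ ∈ Iio ζ,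
    (cone f η s ∩ {x | ¬ (ξ ∈ f x ↔ ξ ∈ b s)})) (mk_powerset_Iio_lt hpow hη)
    fun s => hI.biUnion hζ fun ξ hξ => ?_)
  · rintro x ⟨hxC, hxζ⟩
    exact mem_iUnion.2 ⟨⟨f x ∩ Iio η, inter_subset_right⟩,
      mem_iUnion₂.2 ⟨ψ x, hxζ, rfl, (hψ x hxC).2⟩⟩
  · have hξ' := hξ.trans hζ
    by_cases hb : ξ ∈ b s
    · refine hI.mono ?_ ((hsplit s s.2 ξ hξ').resolve_left hb.2)
      rintro x ⟨hx, hx'⟩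
      exact ⟨hx, fun h => hx' ⟨fun _ => hb, fun _ => h⟩⟩
    · have : N D' δ (cone f η s ∩ {x | ξ ∈ f x}) := by
        by_contra h
        exact hb ⟨hξ', h⟩
      refine hI.mono ?_ this
      rintro x ⟨hx, hx'⟩
      refine ⟨hx, ?_⟩
      by_contra h
      exact hx' ⟨fun h' => absurd h' h, fun h' => absurd h' hb⟩

/-! ### Order types and the ideals projected to lam -/

theorem lift_card_otp {A : Set Ordinal.{u}} {b : Ordinal.{u}} (hA : A ⊆ Iio b) :
    Cardinal.lift.{u + 1} (otp A).card = #A := by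
  obtain ⟨f⟩ := nonempty_orderIso_otp hA
  rw [← Cardinal.mk_Iio_ordinal]
  exact mk_congr f.toEquiv

theorem le_otp_of_strictMono {A : Set Ordinal.{u}} {b η : Ordinal.{u}} (hA : A ⊆ Iio b)
    {g : Iio η → A} (hg : StrictMono g) : η ≤ otp A := by
  obtain ⟨f⟩ := nonempty_orderIso_otp hA
  have h : typeLT (Iio η) ≤ typeLT (Iio (otp A)) :=
    Ordinal.type_le_iff'.2 ⟨(OrderEmbedding.ofStrictMono (fun x => f.symm (g x))
      (f.symm.strictMono.comp hg)).ltEmbedding⟩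
  rwa [Ordinal.type_lt_Iio, Ordinal.type_lt_Iio, Ordinal.lift_le] at h

/-- The set `C ∩ Iio β` lies in a proper initial segment of `C`, which has fewer than `lam`
elements. -/
theorem otp_inter_Iio_lt {lam : Cardinal.{u}} {C : Set Ordinal.{u}} {δ β : Ordinal.{u}}
    (hC : IsClubIn C δ) (hCb : otp C ≤ lam.ord) (hβ : β < δ) : otp (C ∩ Iio β) < lam.ord := by
  obtain ⟨c, hc, hβc⟩ := hC.exists_ge hβ
  obtain ⟨f⟩ := nonempty_orderIso_otp hC.1
  rw [lt_ord, ← Cardinal.lift_lt.{u, u + 1},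
    lift_card_otp (inter_subset_right : C ∩ Iio β ⊆ Iio β)]
  refine lt_of_le_of_lt ?_
    (mk_Iio_lt (show (f.symm ⟨c, hc⟩ : Ordinal.{u}) < lam.ord from (f.symm ⟨c, hc⟩).2.trans_le hCb))
  refine mk_le_of_injective (f := fun x : ↥(C ∩ Iio β) => (⟨f.symm ⟨x.1, x.2.1⟩, ?_⟩ :
    Iio (f.symm ⟨c, hc⟩ : Ordinal.{u}))) fun x y h => ?_
  · exact f.symm.strictMono (show x.1 < c from lt_of_lt_of_le x.2.2 hβc)
  · have h' := f.symm.injective (Subtype.ext (congrArg (fun z : Iio (f.symm ⟨c, hc⟩ : Ordinal.{u}) => z.1) h))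
    exact Subtype.ext (congrArg (fun z : C => z.1) h')

/-- A cofinal set in `δ` has at least `lam` elements, so `C` has an `η`-th element, and this is the
bound. -/
theorem exists_forall_otp_lt_imp_lt {lam : Cardinal.{u}} {C : Set Ordinal.{u}} {δ : Ordinal.{u}}
    (hC : IsClubIn C δ) (hδ : δ.cof = lam) {η : Ordinal.{u}} (hη : η < lam.ord) :
    ∃ γ < δ, ∀ β < δ, otp (C ∩ Iio β) < η → β < γ := by
  obtain ⟨f⟩ := nonempty_orderIso_otp hC.1
  have hcard : Cardinal.lift.{u + 1} lam ≤ #C := by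
    have h := Order.cof_le hC.2.isCofinal
    rw [cof_Iio, ← Ordinal.lift_cof, hδ] at h
    refine h.trans (mk_le_of_injective
      (f := fun x : {x : Iio δ | x.1 ∈ C} => (⟨x.1.1, x.2⟩ : C)) fun x y hxy => ?_)
    exact Subtype.ext (Subtype.ext (congrArg (fun z : C => z.1) hxy))
  have hηotp : η < otp C := by
    by_contra! hle
    rw [← lift_card_otp hC.1, Cardinal.lift_le] at hcard
    exact (hcard.trans (Ordinal.card_le_card hle)).not_gt (lt_ord.1 hη)
  refine ⟨f ⟨η, hηotp⟩, hC.1 (f ⟨η, hηotp⟩).2, fun β hβ hlt => ?_⟩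
  by_contra! hle
  refine hlt.not_ge (le_otp_of_strictMono (inter_subset_right : C ∩ Iio β ⊆ Iio β)
    (g := fun x => ⟨f ⟨x.1, lt_trans x.2 hηotp⟩, (f _).2, ?_⟩) fun x y hxy => ?_)
  · have h : f ⟨x.1, lt_trans x.2 hηotp⟩ < f ⟨η, hηotp⟩ :=
      f.strictMono (show (⟨x.1, lt_trans x.2 hηotp⟩ : Iio (otp C)) < ⟨η, hηotp⟩ from x.2)
    exact lt_of_lt_of_le (show (f _).1 < (f _).1 from h) hle
  · exact f.strictMono (show (⟨x.1, lt_trans x.2 hηotp⟩ : Iio (otp C)) <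
      ⟨y.1, lt_trans y.2 hηotp⟩ from hxy)

theorem IsCompleteIdealOver.iUnion_mem {lam : Cardinal.{u}} {δ : Ordinal.{u}}
    {J : Order.Ideal (Set (Iio δ))} (hJ : IsCompleteIdealOver lam J) {ι : Type (u + 1)}
    {X : ι → Set (Iio δ)} (hι : #ι < Cardinal.lift.{u + 1} lam) (hX : ∀ i, X i ∈ J) :
    (⋃ i, X i) ∈ J := by
  obtain ⟨c, hclam, hc⟩ := Cardinal.lt_lift_iff.1 hι
  have : Nonempty (c.out ≃ ι) := by
    rw [← Cardinal.lift_mk_eq', mk_out, hc, Cardinal.lift_id'.{u, u + 1}]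
  obtain ⟨g⟩ := this
  rw [← g.surjective.iUnion_comp X]
  exact hJ.complete c.out (fun i => X (g i)) (by rwa [mk_out]) fun i => hX _

/-- The ideal `J δ`, restricted to the points where `C δ` guesses `D`,
projected along `β ↦ otp (C δ ∩ β)`. -/
def guessNull (κ lam : Cardinal.{u}) (T : Set Ordinal.{u})
    (J : ∀ δ : Ordinal.{u}, Order.Ideal (Set (Iio δ))) (C : Ordinal.{u} → Set Ordinal.{u})
    (D : {D : Set Ordinal.{u} // IsClubIn D κ.ord}) (δ : cofSet κ lam)
    (S : Set Ordinal.{u}) : Prop :=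
  {β : Iio δ.1 | otp (C δ ∩ Iio (β : Ordinal.{u})) ∈ S ∧ nextIn (C δ) β ∈ D.1 ∩ T} ∈ J δ

theorem isGuessing_guessNull {κ lam : Cardinal.{u}} (hκ : κ.IsRegular) (hlam : ℵ₀ < lam)
    (hlamκ : lam < κ) {T : Set Ordinal.{u}}
    {J : ∀ δ : Ordinal.{u}, Order.Ideal (Set (Iio δ))}
    (hJ : ∀ δ ∈ cofSet κ lam, IsCompleteIdealOver lam (J δ))
    {C : Ordinal.{u} → Set Ordinal.{u}} (hC : IsCSequence (cofSet κ lam) C)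
    (hCb : IsBoundedBy (cofSet κ lam) C lam.ord)
    (hguess : ∀ D : Set Ordinal.{u}, IsClubIn D κ.ord →
      ∃ δ ∈ cofSet κ lam, {β : Iio δ | nextIn (C δ) β ∈ D ∩ T} ∉ J δ) :
    IsGuessing lam (guessNull κ lam T J C) where
  ideal := fun D δ =>
    { mono := fun hS h => (J δ).lower (fun β hβ => And.intro (hS hβ.1) hβ.2) h
      iUnion := fun X hι hX => by
        refine (J δ).lower ?_ ((hJ δ δ.2).iUnion_mem hι hX)
        rintro β ⟨hβ, hβ'⟩
        obtain ⟨i, hi⟩ := mem_iUnion.1 hβ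
        exact mem_iUnion.2 ⟨i, hi, hβ'⟩
      bounded := fun η hη => by
        obtain ⟨γ, hγ, h⟩ := exists_forall_otp_lt_imp_lt (hC δ δ.2) δ.2.2 hη
        exact (J δ).lower (fun β hβ => h β β.2 hβ.1) ((hJ δ δ.2).bounded γ hγ)
      compl := by
        refine (J δ).lower ?_ (J δ).bot_mem
        rintro β ⟨hβ, -⟩
        exact absurd (otp_inter_Iio_lt (hC δ δ.2) (hCb δ δ.2) β.2) (not_lt.2 hβ) }
  anti hD h := (J _).lower (fun β hβ => And.intro hβ.1 (And.intro (hD hβ.2.1) hβ.2.2)) h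
  exists_pos D := by
    obtain ⟨δ, hδ, h⟩ := hguess D.1 D.2
    exact ⟨⟨δ, hδ⟩, fun h' => h ((J δ).lower (fun β hβ => And.intro trivial hβ) h')⟩
  directed f hι :=
    ⟨⟨_, IsClubIn.inter_iInter hκ (hlam.trans hlamκ)
      (hι.trans_lt (Cardinal.lift_lt.2 hlamκ)) fun i => (f i).2⟩,
      fun i => inter_subset_right.trans (iInter_subset _ i)⟩

theorem aleph0_le_of_isLeast {lam θ : Cardinal.{u}} (hlam : ℵ₀ < lam)
    (hθ : IsLeast {μ : Cardinal.{u} | lam ≤ 2 ^ μ} θ) : ℵ₀ ≤ θ := by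
  by_contra! h
  have h1 : lam ≤ 2 ^ θ := hθ.1
  exact (hlam.trans_le h1).not_gt (power_lt_aleph0 ofNat_lt_aleph0 h)

end ClubGuessing

theorem theoremD (κ lam θ : Cardinal.{u}) (hκ : κ.IsRegular) (hlam : ℵ₀ < lam) (hlamκ : lam < κ)
    (T : Set Ordinal.{u})
    (J : ∀ δ : Ordinal.{u}, Order.Ideal (Set (Iio δ)))
    (hJ : ∀ δ ∈ ClubGuessing.cofSet κ lam, ClubGuessing.IsCompleteIdealOver lam (J δ))
    (C : Ordinal.{u} → Set Ordinal.{u})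
    (hC : ClubGuessing.IsCSequence (ClubGuessing.cofSet κ lam) C)
    (hCb : ClubGuessing.IsBoundedBy (ClubGuessing.cofSet κ lam) C lam.ord)
    (hguess : ∀ D : Set Ordinal.{u}, ClubGuessing.IsClubIn D κ.ord →
      ∃ δ ∈ ClubGuessing.cofSet κ lam,
        {β : Iio δ | ClubGuessing.nextIn (C δ) β ∈ D ∩ T} ∉ J δ)
    (hyp :
      (θ = lam ∧ ClubGuessing.DiamondStar lam) ∨
      (¬ lam.IsInaccessible ∧ IsLeast {μ : Cardinal.{u} | lam ≤ 2 ^ μ} θ) ∨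
      (Order.succ θ = lam) ∨
      (θ = ℵ₀ ∧ ¬ ClubGuessing.IsIneffable lam)) :
    ∃ h : Ordinal.{u} → Ordinal.{u} → Ordinal.{u},
      (∀ δ ∈ ClubGuessing.cofSet κ lam, MapsTo (h δ) (Iio lam.ord) (Iio θ.ord)) ∧
      ∀ D : Set Ordinal.{u}, ClubGuessing.IsClubIn D κ.ord →
        ∃ δ ∈ ClubGuessing.cofSet κ lam, ∀ τ < θ.ord,
          {β : Iio δ | h δ (ClubGuessing.otp (C δ ∩ Iio (β : Ordinal.{u}))) = τ ∧
            ClubGuessing.nextIn (C δ) β ∈ D ∩ T} ∉ J δ := by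
  classical
  have hN := ClubGuessing.isGuessing_guessNull hκ hlam hlamκ hJ hC hCb hguess
  -- Guessing provides some `δ` of cofinality `lam`, and infinite cofinalities are regular.
  have hreg : lam.IsRegular := by
    obtain ⟨D, -⟩ := hN.directed (ι := PEmpty) PEmpty.elim (by simp)
    obtain ⟨δ, -⟩ := hN.exists_pos D
    have hδ : ℵ₀ ≤ δ.1.cof := by rw [δ.2.2]; exact hlam.le
    have hδreg := isRegular_cof (one_lt_cof_iff.1 (aleph0_le_cof_iff.1 hδ))
    rwa [δ.2.2] at hδreg
  have hpart : ClubGuessing.Partitions (ClubGuessing.guessNull κ lam T J C) θ := by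
    rcases hyp with ⟨rfl, hdia⟩ | ⟨hinacc, hleast⟩ | hsucc | ⟨rfl, hineff⟩
    · exact hN.partitions_of_diamondStar hlam hdia
    · have hlt : ∃ μ < lam, lam ≤ 2 ^ μ := by
        by_contra! hpow
        exact hinacc ⟨hlam, hreg.2, fun μ hμ => hpow μ hμ⟩
      obtain ⟨μ, hμ, hle⟩ := hlt
      exact hN.partitions_of_isLeast hlam hreg (ClubGuessing.aleph0_le_of_isLeast hlam hleast)
        ((hleast.2 hle).trans_lt hμ) hleast
    · refine hN.partitions_of_succ_eq ?_ hsucc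
      rw [← Order.lt_succ_iff, hsucc]
      exact hlam
    · by_cases hpow : ∀ μ < lam, 2 ^ μ < lam
      · exact hN.partitions_of_not_isIneffable hlam hreg hpow hineff
      -- If `lam` is not a strong limit, the least exponent `ν` with 2^ν ≥ `lam` is infinite and
      -- below `lam`; its partition is merged into ω classes.
      · push Not at hpow
        obtain ⟨μ, hμ, hle⟩ := hpow
        have hleast : IsLeast {μ : Cardinal.{u} | lam ≤ 2 ^ μ} _ :=
          ⟨csInf_mem ⟨μ, hle⟩, fun ν hν => csInf_le' hν⟩
        have hθ := ClubGuessing.aleph0_le_of_isLeast hlam hleast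
        exact (hN.partitions_of_isLeast hlam hreg hθ ((hleast.2 hle).trans_lt hμ) hleast).of_le hθ
          aleph0_ne_zero fun D δ => (hN.ideal D δ).mono
  obtain ⟨h, h1, h2⟩ := hpart
  refine ⟨fun δ => if hδ : δ ∈ ClubGuessing.cofSet κ lam then h ⟨δ, hδ⟩ else fun _ => 0,
    fun δ hδ x _ => ?_, fun D hD => ?_⟩
  · simp only [dif_pos hδ]
    exact h1 _ _
  · obtain ⟨δ, hδ⟩ := h2 ⟨D, hD⟩
    refine ⟨δ, δ.2, fun τ hτ => ?_⟩
    simp only [dif_pos δ.2]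
    exact hδ τ hτ
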